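/- Let $n\ge 1$, $T>0$, $P\ge 0$, $q\ge 0$, and let $\varphi_1,\dots,\varphi_n:[0,T]\to\mathbb R$ be measurable, square integrable and orthonormal in $L^2([0,T])$. Let $A=(A_1,\dots,A_n)$ be a random vector with law $\theta$, let $X_t=\sum_{i=1}^n A_i\varphi_i(t)$, and let $Y_t=\int_0^t X_s\,ds+W_t$ for $0\le t\le T$ (i.e. $dY_t=X_t\,dt+dW_t$), where $W$ is a standard Brownian motion independent of $A$. A (causal) filter $\hat X$ is a jointly measurable family of functions $\hat X_t$ of the observed path such that $\hat X_t$ depends only on $Y^t=\{Y_s:0\le s\le t\}$. With $l(x,\hat x)=\tfrac12(x-\hat x)^2$, define $$\mathrm{cmle}(\theta,\hat X)=E_\theta\Big[\int_0^T l\big(X_t,\hat X_t(Y^t)\big)\,dt\Big],\qquad R(\theta,\hat X)=\mathrm{cmle}(\theta,\hat X)-E_\theta\Big[\int_0^T l\big(X_t,E_\theta[X_t\mid Y^t]\big)\,dt\Big],$$ and, for a set $\Theta$ of laws on $\mathbb R^n$, $$\mathrm{minimax}(\Theta)=\inf_{\hat X}\ \sup_{\theta\in\Theta}R(\theta,\hat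 X),$$ the infimum being over all causal filters. Let $\Theta$ be the set of all probability laws $\theta$ on $\mathbb R^n$ with $$\theta\Big(\tfrac1n\sum_{i=1}^n A_i^2\le P\Big)=1\quad\text{and}\quad \theta\Big(\tfrac1n\sum_{i=1}^n \mathbf 1_{\{A_i\ne 0\}}\le q\Big)=1,$$ and let $\Theta_D$ be the set of all laws $\theta$ with $\theta(A=a)=1$ for some deterministic $a\in\mathbb R^n$ satisfying $\tfrac1n\sum_i a_i^2\le P$ and $\tfrac1n\sum_i\mathbf 1_{\{a_i\neq0\}}\le q$. Then $$\mathrm{minimax}(\Theta_D)=\mathrm{minimax}(\Theta).$$ -/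

import Mathlib

open MeasureTheory ProbabilityTheory Set
open scoped NNReal ENNReal

noncomputable section

namespace SparseFiltering

/-- The space `C([0,T])` of continuous observation paths `y^T`. -/
abbrev Path (T : ℝ) : Type := C(Icc (0 : ℝ) T, ℝ)

/-- The cylinder σ-algebra on the path space, generated by the evaluations `y ↦ y s`. -/
instance instMeasurableSpacePath (T : ℝ) : MeasurableSpace (Path T) :=
  MeasurableSpace.comap (fun (y : Path T) (s : Icc (0 : ℝ) T) => y s) MeasurableSpace.pi

/-- Orthonormal signals `φ_1, …, φ_n` in `L²([0,T])`. -/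
structure OrthonormalSignals (n : ℕ) (T : ℝ) where
  φ : Fin n → ℝ → ℝ
  measurable : ∀ i, Measurable (φ i)
  memLp : ∀ i, MemLp (φ i) 2 (volume.restrict (Icc 0 T))
  orthonormal : ∀ i j, ∫ t in Icc 0 T, φ i t * φ j t = if i = j then 1 else 0

/-- A standard real Brownian motion on the probability space `(Ω, ν)`, all of whose paths are
continuous. -/
structure StandardBrownianMotion {Ω : Type*} [MeasurableSpace Ω] (ν : Measure Ω) where
  W : ℝ≥0 → Ω → ℝ
  measurable : ∀ t, Measurable (W t)
  continuous : ∀ ω, Continuous fun t => W t ω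
  isBrownian : IsBrownianReal W ν

variable {n : ℕ} {T : ℝ}

/-- The input signal `X_t = ∑ i, a_i φ_i(t)` with coefficient vector `a`. -/
def signal (S : OrthonormalSignals n T) (a : Fin n → ℝ) (t : ℝ) : ℝ :=
  ∑ i, a i * S.φ i t

lemma continuous_primitive_signal (S : OrthonormalSignals n T) (a : Fin n → ℝ) :
    Continuous fun t : Icc (0 : ℝ) T => ∫ s in (0 : ℝ)..t, signal S a s := by
  by_cases hT : 0 ≤ T
  · have hint : IntegrableOn (signal S a) (Icc 0 T) := by
      unfold signal
      refine integrable_finsetSum _ fun i _ => ?_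
      exact ((S.memLp i).integrable (by norm_num)).const_mul (a i)
    have h := intervalIntegral.continuousOn_primitive_interval (μ := volume)
      (a := (0 : ℝ)) (b := T) (f := signal S a) (by rwa [uIcc_of_le hT])
    rw [uIcc_of_le hT] at h
    exact continuousOn_iff_continuous_domRestrict.1 h
  · have : IsEmpty (Icc (0 : ℝ) T) := ⟨fun t => hT (t.2.1.trans t.2.2)⟩
    exact continuous_of_discreteTopology

variable {Ω : Type*} [MeasurableSpace Ω] {ν : Measure Ω}

/-- The channel output `Y_t = ∫_0^t X_s ds + W_t`, `0 ≤ t ≤ T`, that is `dY_t = X_t dt + dW_t`.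
A sample point is a pair `(a, ω)`: the coefficient vector and the outcome of the noise. -/
def output (S : OrthonormalSignals n T) (B : StandardBrownianMotion ν)
    (p : (Fin n → ℝ) × Ω) : Path T where
  toFun t := (∫ s in (0 : ℝ)..t, signal S p.1 s) + B.W ⟨t, t.2.1⟩ p.2
  continuous_toFun := (continuous_primitive_signal S p.1).add
    ((B.continuous p.2).comp (continuous_subtype_val.subtype_mk _))

/-- The σ-algebra generated by `Y^t = {Y_s, 0 ≤ s ≤ t}`. -/
@[reducible] def outputSigma (S : OrthonormalSignals n T) (B : StandardBrownianMotion ν) (t : ℝ) :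
    MeasurableSpace ((Fin n → ℝ) × Ω) :=
  ⨆ s : Icc (0 : ℝ) T, ⨆ _ : (s : ℝ) ≤ t,
    MeasurableSpace.comap (fun p => output S B p s) inferInstance

/-- The law of (coefficients, noise) when the coefficient vector has law `θ`: the noise is
independent of the input. -/
def jointLaw (ν : Measure Ω) (θ : ProbabilityMeasure (Fin n → ℝ)) :
    Measure ((Fin n → ℝ) × Ω) :=
  (θ : Measure (Fin n → ℝ)).prod ν

/-- A causal filter: a jointly measurable family of functions `y ↦ X̂_t(y)` of the observed path
where, for `0 ≤ t ≤ T`, `X̂_t(y)` depends only on the restriction of `y` to `[0,t]`. -/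
structure CausalFilter (T : ℝ) where
  est : ℝ → Path T → ℝ
  measurable : Measurable (Function.uncurry est)
  causal : ∀ t ∈ Icc (0 : ℝ) T, ∀ y y' : Path T,
    (∀ s : Icc (0 : ℝ) T, (s : ℝ) ≤ t → y s = y' s) → est t y = est t y'

/-- Half the squared error. -/
def loss (x z : ℝ) : ℝ := (1 / 2) * (x - z) ^ 2

/-- The causal error `E_θ[∫_0^T l(X_t, X̂_t(Y^t)) dt]` of a filter. -/
def cmle (S : OrthonormalSignals n T) (B : StandardBrownianMotion ν)
    (θ : ProbabilityMeasure (Fin n → ℝ)) (F : CausalFilter T) : ℝ≥0∞ :=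
  ∫⁻ p, (∫⁻ t in Icc (0 : ℝ) T,
    ENNReal.ofReal (loss (signal S p.1 t) (F.est t (output S B p)))) ∂(jointLaw ν θ)

/-- The Bayes estimate `E_θ[X_t | Y^t]` under the true law `θ`. -/
def bayesEstimate (S : OrthonormalSignals n T) (B : StandardBrownianMotion ν)
    (θ : ProbabilityMeasure (Fin n → ℝ)) (t : ℝ) : (Fin n → ℝ) × Ω → ℝ :=
  (jointLaw ν θ)[fun p => signal S p.1 t | outputSigma S B t]

/-- The causal error of the Bayes filter `E_θ[X_t | Y^t]` under its own law `θ`. The time integral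
is taken outside the expectation, so that the value does not depend on the versions of the
conditional expectations; see `cmle_eq_bayesCmle`. -/
def bayesCmle (S : OrthonormalSignals n T) (B : StandardBrownianMotion ν)
    (θ : ProbabilityMeasure (Fin n → ℝ)) : ℝ≥0∞ :=
  ∫⁻ t in Icc (0 : ℝ) T, (∫⁻ p,
    ENNReal.ofReal (loss (signal S p.1 t) (bayesEstimate S B θ t p)) ∂(jointLaw ν θ))

/-- The regret of a filter when `θ` is the true law of the coefficients. -/
def regret (S : OrthonormalSignals n T) (B : StandardBrownianMotion ν)
    (θ : ProbabilityMeasure (Fin n → ℝ)) (F : CausalFilter T) : EReal :=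
  (cmle S B θ F : EReal) - (bayesCmle S B θ : EReal)

/-- The minimax regret over a class `Θ` of laws of the coefficient vector. -/
def minimax (S : OrthonormalSignals n T) (B : StandardBrownianMotion ν)
    (Θ : Set (ProbabilityMeasure (Fin n → ℝ))) : EReal :=
  ⨅ F : CausalFilter T, ⨆ θ ∈ Θ, regret S B θ F

/-- The power constraint `(1/n) ∑ a_i² ≤ P`. -/
def PowerConstraint (P : ℝ) (a : Fin n → ℝ) : Prop :=
  (1 / (n : ℝ)) * ∑ i, a i ^ 2 ≤ P

/-- The sparsity constraint `(1/n) ∑ 1(a_i ≠ 0) ≤ q`. -/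
def SparsityConstraint (q : ℝ) (a : Fin n → ℝ) : Prop :=
  (1 / (n : ℝ)) * ∑ i, (if a i ≠ 0 then (1 : ℝ) else 0) ≤ q

/-- All laws of the coefficient vector satisfying both constraints almost surely. -/
def sparseLaws (n : ℕ) (P q : ℝ) : Set (ProbabilityMeasure (Fin n → ℝ)) :=
  {θ | (θ : Measure (Fin n → ℝ)) {a | PowerConstraint P a} = 1 ∧
    (θ : Measure (Fin n → ℝ)) {a | SparsityConstraint q a} = 1}

/-- All deterministic laws of a coefficient vector satisfying both constraints. -/
def deterministicLaws (n : ℕ) (P q : ℝ) : Set (ProbabilityMeasure (Fin n → ℝ)) :=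
  {θ | ∃ a : Fin n → ℝ, (θ : Measure (Fin n → ℝ)) {a} = 1 ∧
    PowerConstraint P a ∧ SparsityConstraint q a}

lemma measurable_signal (S : OrthonormalSignals n T) :
    Measurable fun x : ((Fin n → ℝ) × ℝ) => signal S x.1 x.2 := by
  unfold signal
  exact Finset.measurable_sum _ fun i _ =>
    ((measurable_pi_apply i).comp measurable_fst).mul ((S.measurable i).comp measurable_snd)

lemma measurable_output (S : OrthonormalSignals n T) (B : StandardBrownianMotion ν) :
    Measurable (output S B) := by
  refine Measurable.of_comap_le ?_
  rw [instMeasurableSpacePath, MeasurableSpace.comap_comp, ← measurable_iff_comap_le]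
  refine measurable_pi_lambda _ fun t => ?_
  have h : Measurable fun a : Fin n → ℝ => ∫ s in (0 : ℝ)..t, signal S a s := by
    simp only [intervalIntegral.integral_of_le t.2.1]
    exact ((measurable_signal S).stronglyMeasurable.integral_prod_right
      (f := fun a s => signal S a s)).measurable
  exact (h.comp measurable_fst).add ((B.measurable _).comp measurable_snd)

/-- If a causal filter is a version of the Bayes filter under `θ`, then its error under `θ` is
`bayesCmle`. -/
lemma cmle_eq_bayesCmle [SFinite ν] (S : OrthonormalSignals n T) (B : StandardBrownianMotion ν)
    (θ : ProbabilityMeasure (Fin n → ℝ)) (F : CausalFilter T)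
    (hF : ∀ t ∈ Icc (0 : ℝ) T, (fun p => F.est t (output S B p)) =ᵐ[jointLaw ν θ] bayesEstimate S B θ t) :
    cmle S B θ F = bayesCmle S B θ := by
  have : SFinite (jointLaw ν θ) := by unfold jointLaw; infer_instance
  unfold cmle bayesCmle
  rw [lintegral_lintegral_swap]
  · refine setLIntegral_congr_fun measurableSet_Icc fun t ht => lintegral_congr_ae ?_
    filter_upwards [hF t ht] with p hp
    rw [hp]
  · have h1 : Measurable fun x : ((Fin n → ℝ) × Ω) × ℝ => signal S x.1.1 x.2 :=
      (measurable_signal S).comp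
        ((measurable_fst.comp measurable_fst).prodMk measurable_snd)
    have h2 : Measurable fun x : ((Fin n → ℝ) × Ω) × ℝ =>
        F.est x.2 (output S B x.1) :=
      F.measurable.comp (measurable_snd.prodMk ((measurable_output S B).comp measurable_fst))
    exact (((h1.sub h2).pow_const 2).const_mul (1 / 2)).ennreal_ofReal.aemeasurable

end SparseFiltering

end

/-! The two minimax values agree because, for each fixed causal filter, the supremum of the regret
over all admissible laws equals its supremum over admissible point masses. Under a point mass `δ_a`
the signal is known, so the Bayes filter makes no error (`bayesCmle_eq_zero`) and the regret is
the causal error itself. The causal error is affine in the law, namely the `θ`-average of the errors under the point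
masses `δ_a` (`cmle_eq_lintegral`), so it is at most the worst deterministic regret. Subtracting the
nonnegative Bayes error only lowers it. The opposite inequality holds since point masses on
admissible vectors are admissible laws. -/

open MeasureTheory ProbabilityTheory Set

namespace SparseFiltering

variable {n : ℕ} {T : ℝ} {Ω : Type*} [MeasurableSpace Ω] {ν : Measure Ω}

lemma outputSigma_le (S : OrthonormalSignals n T) (B : StandardBrownianMotion ν) (t : ℝ) :
    outputSigma S B t ≤ (inferInstance : MeasurableSpace ((Fin n → ℝ) × Ω)) := by
  refine iSup_le fun s => iSup_le fun _ => ?_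
  have h : Measurable fun y : Path T => y s :=
    (measurable_pi_apply s).comp (comap_measurable fun (y : Path T) (s : Icc (0 : ℝ) T) => y s)
  exact (h.comp (measurable_output S B)).comap_le

/-- The causal error of the filter `F` when the coefficient vector is the constant `a`. -/
noncomputable def deterministicError (S : OrthonormalSignals n T) (B : StandardBrownianMotion ν)
    (F : CausalFilter T) (a : Fin n → ℝ) : ENNReal :=
  ∫⁻ ω, (∫⁻ t in Icc (0 : ℝ) T,
    ENNReal.ofReal (loss (signal S a t) (F.est t (output S B (a, ω))))) ∂ν

lemma cmle_eq_lintegral [SFinite ν] (S : OrthonormalSignals n T) (B : StandardBrownianMotion ν)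
    (θ : ProbabilityMeasure (Fin n → ℝ)) (F : CausalFilter T) :
    cmle S B θ F = ∫⁻ a, deterministicError S B F a ∂(θ : Measure (Fin n → ℝ)) := by
  have h1 : Measurable fun x : ((Fin n → ℝ) × Ω) × ℝ => signal S x.1.1 x.2 :=
    (measurable_signal S).comp ((measurable_fst.comp measurable_fst).prodMk measurable_snd)
  have h2 : Measurable fun x : ((Fin n → ℝ) × Ω) × ℝ => F.est x.2 (output S B x.1) :=
    F.measurable.comp (measurable_snd.prodMk ((measurable_output S B).comp measurable_fst))
  have h3 : Measurable fun x : ((Fin n → ℝ) × Ω) × ℝ =>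
      ENNReal.ofReal (loss (signal S x.1.1 x.2) (F.est x.2 (output S B x.1))) :=
    (((h1.sub h2).pow_const 2).const_mul (1 / 2)).ennreal_ofReal
  exact lintegral_prod _ h3.lintegral_prod_right'.aemeasurable

lemma ae_eq_of_measure_singleton {θ : ProbabilityMeasure (Fin n → ℝ)} {a : Fin n → ℝ}
    (h : (θ : Measure (Fin n → ℝ)) {a} = 1) : ∀ᵐ x ∂(θ : Measure (Fin n → ℝ)), x = a :=
  (mem_ae_iff_prob_eq_one (measurableSet_singleton a)).2 h

lemma cmle_eq_deterministicError [SFinite ν] (S : OrthonormalSignals n T)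
    (B : StandardBrownianMotion ν) {θ : ProbabilityMeasure (Fin n → ℝ)} {a : Fin n → ℝ}
    (h : (θ : Measure (Fin n → ℝ)) {a} = 1) (F : CausalFilter T) :
    cmle S B θ F = deterministicError S B F a := by
  have hae : deterministicError S B F =ᵐ[(θ : Measure (Fin n → ℝ))]
      fun _ => deterministicError S B F a := by
    filter_upwards [ae_eq_of_measure_singleton h] with x hx
    rw [hx]
  rw [cmle_eq_lintegral, lintegral_congr_ae hae, lintegral_const, measure_univ, mul_one]

/-- Under a deterministic law the signal is almost surely constant, so it equals its conditional
expectation given the observations. -/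
lemma bayesCmle_eq_zero [IsProbabilityMeasure ν] (S : OrthonormalSignals n T)
    (B : StandardBrownianMotion ν) {θ : ProbabilityMeasure (Fin n → ℝ)} {a : Fin n → ℝ}
    (h : (θ : Measure (Fin n → ℝ)) {a} = 1) : bayesCmle S B θ = 0 := by
  have : IsProbabilityMeasure (jointLaw ν θ) := by unfold jointLaw; infer_instance
  have hfst : ∀ᵐ p ∂(jointLaw ν θ), p.1 = a :=
    Measure.quasiMeasurePreserving_fst.ae (ae_eq_of_measure_singleton h)
  have hzero : ∀ t, ∫⁻ p, ENNReal.ofReal (loss (signal S p.1 t) (bayesEstimate S B θ t p))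
      ∂(jointLaw ν θ) = 0 := by
    intro t
    have hsig : (fun p : (Fin n → ℝ) × Ω => signal S p.1 t) =ᵐ[jointLaw ν θ]
        fun _ => signal S a t := by
      filter_upwards [hfst] with p hp
      rw [hp]
    have hbayes : bayesEstimate S B θ t =ᵐ[jointLaw ν θ] fun _ => signal S a t := by
      refine (condExp_congr_ae hsig).trans (Filter.EventuallyEq.of_eq ?_)
      exact condExp_const (outputSigma_le S B t) (signal S a t)
    refine lintegral_eq_zero_of_ae_eq_zero ?_
    filter_upwards [hsig, hbayes] with p h1 h2
    simp [h1, h2, loss]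
  simp [bayesCmle, hzero]

lemma regret_eq_deterministicError [IsProbabilityMeasure ν] (S : OrthonormalSignals n T)
    (B : StandardBrownianMotion ν) {θ : ProbabilityMeasure (Fin n → ℝ)} {a : Fin n → ℝ}
    (h : (θ : Measure (Fin n → ℝ)) {a} = 1) (F : CausalFilter T) :
    regret S B θ F = deterministicError S B F a := by
  simp [regret, bayesCmle_eq_zero S B h, cmle_eq_deterministicError S B h]

lemma measurableSet_powerConstraint (P : ℝ) :
    MeasurableSet {a : Fin n → ℝ | PowerConstraint P a} :=
  measurableSet_le (by fun_prop) measurable_const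

lemma measurableSet_sparsityConstraint (q : ℝ) :
    MeasurableSet {a : Fin n → ℝ | SparsityConstraint q a} := by
  refine measurableSet_le (Measurable.const_mul (Finset.measurable_sum _ fun i _ => ?_) _)
    measurable_const
  exact Measurable.ite (measurable_pi_apply i (measurableSet_singleton 0).compl)
    measurable_const measurable_const

lemma deterministicLaws_subset_sparseLaws (P q : ℝ) :
    deterministicLaws n P q ⊆ sparseLaws n P q := by
  rintro θ ⟨a, ha, hP, hq⟩
  have hone {s : Set (Fin n → ℝ)} (hs : a ∈ s) : (θ : Measure (Fin n → ℝ)) s = 1 :=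
    le_antisymm prob_le_one (ha ▸ measure_mono (singleton_subset_iff.2 hs))
  exact ⟨hone hP, hone hq⟩

lemma deterministicError_le_iSup_regret [IsProbabilityMeasure ν] (S : OrthonormalSignals n T)
    (B : StandardBrownianMotion ν) (F : CausalFilter T) {P q : ℝ} {a : Fin n → ℝ}
    (hP : PowerConstraint P a) (hq : SparsityConstraint q a) :
    (deterministicError S B F a : EReal) ≤ ⨆ θ ∈ deterministicLaws n P q, regret S B θ F := by
  let δ : ProbabilityMeasure (Fin n → ℝ) := ⟨Measure.dirac a, inferInstance⟩
  have hδ : (δ : Measure (Fin n → ℝ)) {a} = 1 := by simp [δ]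
  rw [← regret_eq_deterministicError S B hδ F]
  exact le_iSup₂_of_le δ ⟨a, hδ, hP, hq⟩ le_rfl

lemma regret_le_iSup_deterministicLaws [IsProbabilityMeasure ν] (S : OrthonormalSignals n T)
    (B : StandardBrownianMotion ν) (F : CausalFilter T) {P q : ℝ}
    {θ : ProbabilityMeasure (Fin n → ℝ)} (hθ : θ ∈ sparseLaws n P q) :
    regret S B θ F ≤ ⨆ θ ∈ deterministicLaws n P q, regret S B θ F := by
  set s := ⨆ θ ∈ deterministicLaws n P q, regret S B θ F
  have hle : ∀ᵐ a ∂(θ : Measure (Fin n → ℝ)), (deterministicError S B F a : EReal) ≤ s := by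
    filter_upwards [(mem_ae_iff_prob_eq_one (measurableSet_powerConstraint P)).2 hθ.1,
      (mem_ae_iff_prob_eq_one (measurableSet_sparsityConstraint q)).2 hθ.2] with a hP hq
    exact deterministicError_le_iSup_regret S B F hP hq
  -- Some vector is admissible, so the supremum is nonnegative and may be read in `ℝ≥0∞`.
  have hs : 0 ≤ s := by
    obtain ⟨a, ha⟩ := hle.exists
    exact (EReal.coe_ennreal_nonneg _).trans ha
  have hcmle : cmle S B θ F ≤ s.toENNReal := by
    rw [cmle_eq_lintegral]
    calc ∫⁻ a, deterministicError S B F a ∂(θ : Measure (Fin n → ℝ))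
        ≤ ∫⁻ _, s.toENNReal ∂(θ : Measure (Fin n → ℝ)) := by
          refine lintegral_mono_ae ?_
          filter_upwards [hle] with a ha
          rwa [← EReal.coe_ennreal_le_coe_ennreal_iff, EReal.coe_toENNReal hs]
      _ = s.toENNReal := by simp
  calc regret S B θ F ≤ (cmle S B θ F : EReal) - 0 :=
        EReal.sub_le_sub le_rfl (EReal.coe_ennreal_nonneg _)
    _ = (cmle S B θ F : EReal) := sub_zero _
    _ ≤ (s.toENNReal : EReal) := EReal.coe_ennreal_le_coe_ennreal_iff.2 hcmle
    _ = s := EReal.coe_toENNReal hs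

end SparseFiltering

theorem lemma1 {Ω : Type*} [MeasurableSpace Ω] (ν : Measure Ω) [IsProbabilityMeasure ν]
    (B : SparseFiltering.StandardBrownianMotion ν)
    (n : ℕ) (hn : 0 < n) (T : ℝ) (hT : 0 < T)
    (S : SparseFiltering.OrthonormalSignals n T)
    (P q : ℝ) (hP : 0 ≤ P) (hq : 0 ≤ q) :
    SparseFiltering.minimax S B (SparseFiltering.deterministicLaws n P q) =
      SparseFiltering.minimax S B (SparseFiltering.sparseLaws n P q) := by
  refine iInf_congr fun F => le_antisymm ?_ ?_
  · exact biSup_mono fun θ hθ => SparseFiltering.deterministicLaws_subset_sparseLaws P q hθ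
  · exact iSup₂_le fun θ hθ => SparseFiltering.regret_le_iSup_deterministicLaws S B F hθ
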